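/- Let $H$ be a closed subgroup of a locally compact Hausdorff abelian group $G$ (written additively), let $D$ and $E$ be $C^*$-algebras, let $\alpha : H \to \operatorname{Aut} D$ and $\gamma : G \to \operatorname{Aut} E$ be strongly continuous actions (i.e. $g \mapsto \gamma_g(e)$ is norm continuous for each $e$, and similarly for $\alpha$), let $\rho : E \to D$ be a surjective $*$-homomorphism, and let $i : C_0(G/H) \to Z(M(E))$ be a $*$-homomorphism into the centre of the multiplier algebra of $E$ which is $G$-equivariant: $i(\tau_g(k)) = \gamma_g(i(k))$, where $\tau_g(k)(x+H) = k(x-g+H)$ and $\gamma_g$ also denotes the canonical extension of $\gamma_g$ to $M(E)$. Let $\operatorname{ind}_H^G(D,\alpha)$ be the $C^*$-algebra (pointwise operations, supremum norm) of all continuous $f : G \to D$ such that $f(x-h) = \alpha_h(f(x))$ for all $h \in H$, $x \in G$ and such that $x+H \mapsto \|f(x)\|$ belongs to $C_0(G/H)$. Let $\beta_g(f)(x) = f(x-g)$ be the translation action of $G$ on it, let $\pi : \operatorname{ind}_H^G(D,\alpha) \to D$, $\pi(f) = f(0)$, and let $j : C_0(G/H) \to M(\operatorname{ind}_H^G(D,\alpha))$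 be given by pointwise multiplication, $(j(k)f)(x) = k(x+H)f(x)$. Suppose that (i) $\rho(i(k)e) = k(H)\rho(e)$ for all $k \in C_0(G/H)$ and $e \in E$; (ii) $\rho(\gamma_h(e)) = \alpha_h(\rho(e))$ for all $h \in H$ and $e \in E$; (iii) if $e \in E$ and $\rho(\gamma_g(e)) = 0$ for all $g \in G$, then $e = 0$; (iv) $\lim_{x+H \to \infty} \|\rho(\gamma_x(e))\| = 0$ for all $e \in E$. Then there is a $*$-isomorphism $\Psi : E \to \operatorname{ind}_H^G(D,\alpha)$ which is $G$-equivariant ($\Psi(\gamma_g(e)) = \beta_g(\Psi(e))$ for all $g \in G$, $e \in E$) and satisfies $\pi \circ \Psi = \rho$ and $j(k)\Psi(e) = \Psi(i(k)e)$ for all $k \in C_0(G/H)$ and $e \in E$. Moreover, $\Psi$ is the only $G$-equivariant $*$-isomorphism $E \to \operatorname{ind}_H^G(D,\alpha)$ with $\pi \circ \Psi = \rho$. -/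

import Mathlib

open Filter Topology
open scoped ZeroAtInfty BoundedContinuousFunction MultiplierAlgebra

namespace InducedAlgebra

noncomputable section

/-- A strongly continuous action of a topological (additive) group `G` on a C⋆-algebra `A`:
a homomorphism `G → Aut A` such that `g ↦ γ_g a` is norm continuous for each `a`. -/
structure CStarAction (G A : Type*) [AddGroup G] [TopologicalSpace G]
    [NonUnitalCStarAlgebra A] where
  /-- The automorphism attached to a group element. -/
  aut : G → (A ≃⋆ₐ[ℂ] A)
  map_zero : aut 0 = 1
  map_add : ∀ g h, aut (g + h) = aut g * aut h
  continuous_apply : ∀ a : A, Continuous fun g => aut g a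

instance {G A : Type*} [AddGroup G] [TopologicalSpace G] [NonUnitalCStarAlgebra A] :
    CoeFun (CStarAction G A) (fun _ => G → (A ≃⋆ₐ[ℂ] A)) := ⟨CStarAction.aut⟩

/-- A ⋆-automorphism of a C⋆-algebra as a continuous linear map. -/
def autCLM {A : Type*} [NonUnitalCStarAlgebra A] (φ : A ≃⋆ₐ[ℂ] A) : A →L[ℂ] A where
  toFun := φ
  map_add' := map_add φ
  map_smul' := map_smul φ
  cont := (StarAlgEquiv.isometry φ).continuous

/-- The canonical extension of an automorphism `φ` of `A` to the multiplier algebra `M(A)`: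
it sends `m = (L, R)` to `(φ ∘ L ∘ φ⁻¹, φ ∘ R ∘ φ⁻¹)`, so that `φ(m) φ(a) = φ(m a)`. -/
def multiplierAut {A : Type*} [NonUnitalCStarAlgebra A] (φ : A ≃⋆ₐ[ℂ] A) (m : 𝓜(ℂ, A)) :
    𝓜(ℂ, A) where
  fst := (autCLM φ).comp (m.fst.comp (autCLM φ.symm))
  snd := (autCLM φ).comp (m.snd.comp (autCLM φ.symm))
  central x y := by
    change φ (m.snd (φ.symm x)) * y = x * φ (m.fst (φ.symm y))
    have h := congrArg φ (m.central (φ.symm x) (φ.symm y))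
    simpa only [map_mul, StarAlgEquiv.apply_symm_apply] using h

section

variable {G : Type*} [AddCommGroup G] [TopologicalSpace G] [IsTopologicalAddGroup G]
variable (H : AddSubgroup G)

/-- The translation `τ_g` on `C₀(G/H)`: `τ_g(k)(x + H) = k(x - g + H)`. -/
def translateC0 (g : G) (k : C₀(G ⧸ H, ℂ)) : C₀(G ⧸ H, ℂ) :=
  k.comp (Homeomorph.subRight (g : G ⧸ H)).toCocompactMap

theorem translateC0_apply (g x : G) (k : C₀(G ⧸ H, ℂ)) :
    translateC0 H g k (x : G ⧸ H) = k ((x - g : G) : G ⧸ H) := rfl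

variable {H} {D : Type*} [NonUnitalCStarAlgebra D] (α : CStarAction H D)

theorem norm_aut {A : Type*} [NonUnitalCStarAlgebra A] (φ : A ≃⋆ₐ[ℂ] A) (a : A) :
    ‖φ a‖ = ‖a‖ := StarAlgEquiv.norm_map φ a

/-- For a continuous `f` with `f(x - h) = α_h(f(x))`, the function `x + H ↦ ‖f(x)‖` lies in
`C₀(G/H)` if and only if `‖f(x)‖ → 0` as `x + H → ∞`. -/
theorem exists_C0_iff {f : G → D} (hf : Continuous f)
    (hcov : ∀ (x : G) (h : H), f (x - h) = α h (f x)) :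
    (∃ k : C₀(G ⧸ H, ℝ), ∀ x : G, k (x : G ⧸ H) = ‖f x‖) ↔
      Tendsto (fun x => ‖f x‖) (comap (fun x : G => (x : G ⧸ H)) (cocompact (G ⧸ H))) (𝓝 0) := by
  constructor
  · rintro ⟨k, hk⟩
    simp only [← hk]
    exact k.zero_at_infty'.comp tendsto_comap
  · intro h
    have hq : ∀ a b : G, QuotientAddGroup.leftRel H a b → ‖f a‖ = ‖f b‖ := by
      intro a b hab
      rw [QuotientAddGroup.leftRel_apply] at hab
      have := hcov b ⟨-a + b, hab⟩
      rw [show b - ((⟨-a + b, hab⟩ : H) : G) = a by simp] at this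
      rw [this, norm_aut]
    refine ⟨⟨⟨fun y => Quotient.lift (fun x => ‖f x‖) hq y, ?_⟩, ?_⟩, fun x => rfl⟩
    · exact hf.norm.quotient_lift hq
    · intro s hs
      obtain ⟨t, ht, hts⟩ := h hs
      refine Filter.mem_map.2 (mem_of_superset ht fun y hy => ?_)
      obtain ⟨x, rfl⟩ := QuotientAddGroup.mk_surjective y
      exact hts hy

/-- The induced C⋆-algebra `ind_H^G(D, α)`: all continuous `f : G → D` such that
`f(x - h) = α_h(f(x))` and `x + H ↦ ‖f(x)‖` belongs to `C₀(G/H)`, with the pointwise operations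
and the supremum norm.  Such functions are automatically bounded
(see `exists_mem_inducedAlgebra`). -/
def inducedAlgebra : NonUnitalStarSubalgebra ℂ (G →ᵇ D) where
  carrier := {f | (∀ (x : G) (h : H), f (x - h) = α h (f x)) ∧
    ∃ k : C₀(G ⧸ H, ℝ), ∀ x : G, k (x : G ⧸ H) = ‖f x‖}
  zero_mem' := ⟨fun x h => by simp, 0, fun x => by simp⟩
  add_mem' := by
    rintro f g ⟨hf, hf'⟩ ⟨hg, hg'⟩
    have hc : ∀ (x : G) (h : H), (f + g) (x - h) = α h ((f + g) x) := by
      intro x h; simp [hf, hg]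
    refine ⟨hc, (exists_C0_iff α (f + g).continuous hc).2 ?_⟩
    have h1 := (exists_C0_iff α f.continuous hf).1 hf'
    have h2 := (exists_C0_iff α g.continuous hg).1 hg'
    have h3 := h1.add h2
    rw [add_zero] at h3
    exact squeeze_zero (fun x => norm_nonneg _) (fun x => norm_add_le (f x) (g x)) h3
  mul_mem' := by
    rintro f g ⟨hf, hf'⟩ ⟨hg, hg'⟩
    have hc : ∀ (x : G) (h : H), (f * g) (x - h) = α h ((f * g) x) := by
      intro x h; simp [hf, hg]
    refine ⟨hc, (exists_C0_iff α (f * g).continuous hc).2 ?_⟩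
    have h1 := (exists_C0_iff α f.continuous hf).1 hf'
    have h2 := (exists_C0_iff α g.continuous hg).1 hg'
    have h3 := h1.mul h2
    rw [mul_zero] at h3
    exact squeeze_zero (fun x => norm_nonneg _) (fun x => norm_mul_le (f x) (g x)) h3
  smul_mem' := by
    rintro c f ⟨hf, hf'⟩
    have hc : ∀ (x : G) (h : H), (c • f) (x - h) = α h ((c • f) x) := by
      intro x h; simp [hf]
    refine ⟨hc, (exists_C0_iff α (c • f).continuous hc).2 ?_⟩
    have h1 := (exists_C0_iff α f.continuous hf).1 hf'
    have h3 := h1.const_mul ‖c‖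
    rw [mul_zero] at h3
    exact squeeze_zero (fun x => norm_nonneg _) (fun x => norm_smul_le c (f x)) h3
  star_mem' := by
    rintro f ⟨hf, k, hk⟩
    refine ⟨fun x h => ?_, k, fun x => ?_⟩
    · simp [hf, map_star]
    · simp [hk]

theorem mem_inducedAlgebra {f : G →ᵇ D} : f ∈ inducedAlgebra α ↔
    (∀ (x : G) (h : H), f (x - h) = α h (f x)) ∧
      ∃ k : C₀(G ⧸ H, ℝ), ∀ x : G, k (x : G ⧸ H) = ‖f x‖ := Iff.rfl

/-- Boundedness is not a restriction in the definition of the induced algebra. -/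
theorem exists_mem_inducedAlgebra (f : C(G, D))
    (hcov : ∀ (x : G) (h : H), f (x - h) = α h (f x))
    (hf : ∃ k : C₀(G ⧸ H, ℝ), ∀ x : G, k (x : G ⧸ H) = ‖f x‖) :
    ∃ F ∈ inducedAlgebra α, ∀ x, F x = f x := by
  obtain ⟨k, hk⟩ := hf
  refine ⟨BoundedContinuousFunction.ofNormedAddCommGroup f f.continuous ‖k.toBCF‖ fun x => ?_,
    ⟨hcov, k, hk⟩, fun x => rfl⟩
  rw [← hk x]
  exact (le_abs_self _).trans (k.toBCF.norm_coe_le_norm (x : G ⧸ H))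

/-- The induced algebra is norm closed, hence a C⋆-algebra. -/
instance isClosed_inducedAlgebra : IsClosed (inducedAlgebra α : Set (G →ᵇ D)) := by
  rw [← isSeqClosed_iff_isClosed]
  intro F f hF hlim
  have hpt : ∀ x, Tendsto (fun n => F n x) atTop (𝓝 (f x)) := fun x =>
    ((continuous_eval_const (F := G →ᵇ D) x).tendsto f).comp hlim
  have hc : ∀ (x : G) (h : H), f (x - h) = α h (f x) := by
    intro x h
    refine tendsto_nhds_unique (hpt (x - h)) ?_
    have := ((StarAlgEquiv.isometry (α h)).continuous.tendsto (f x)).comp (hpt x)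
    exact this.congr fun n => ((hF n).1 x h).symm
  refine ⟨hc, (exists_C0_iff α f.continuous hc).2 ?_⟩
  rw [Metric.tendsto_nhds]
  intro ε hε
  obtain ⟨n, hn⟩ := ((Metric.tendsto_nhds.1 hlim) (ε / 2) (half_pos hε)).exists
  have h1 := (exists_C0_iff α (F n).continuous (hF n).1).1 (hF n).2
  filter_upwards [(Metric.tendsto_nhds.1 h1) (ε / 2) (half_pos hε)] with x hx
  have h2 : ‖F n x - f x‖ < ε / 2 := by
    rw [← dist_eq_norm]; exact (BoundedContinuousFunction.dist_coe_le_dist x).trans_lt hn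
  simp only [dist_zero_right, norm_norm] at hx ⊢
  calc ‖f x‖ = ‖F n x - (F n x - f x)‖ := by rw [sub_sub_cancel]
    _ ≤ ‖F n x‖ + ‖F n x - f x‖ := norm_sub_le _ _
    _ < ε := by linarith

/-- Evaluation at `0`, the homomorphism `π : ind_H^G(D, α) → D`, `π(f) = f(0)`. -/
def evalZero : inducedAlgebra α →⋆ₙₐ[ℂ] D where
  toFun f := (f : G →ᵇ D) 0
  map_smul' _ _ := rfl
  map_zero' := rfl
  map_add' _ _ := rfl
  map_mul' _ _ := rfl
  map_star' _ := rfl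

/-- The function `x ↦ f(x - g)` for `f` in the induced algebra. -/
def translateFun (g : G) (f : inducedAlgebra α) : inducedAlgebra α :=
  ⟨(f : G →ᵇ D).compContinuous ⟨fun x => x - g, by fun_prop⟩, by
    obtain ⟨f, hf, k, hk⟩ := f
    refine ⟨fun x h => ?_, k.comp (Homeomorph.subRight (g : G ⧸ H)).toCocompactMap, fun x => ?_⟩
    · change f (x - h - g) = α h (f (x - g))
      rw [sub_right_comm, hf]
    · exact hk (x - g)⟩

/-- The translation action `β` of `G` on the induced algebra: `β_g(f)(x) = f(x - g)`. -/
def translation (g : G) : inducedAlgebra α ≃⋆ₐ[ℂ] inducedAlgebra α where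
  toFun := translateFun α g
  invFun := translateFun α (-g)
  left_inv f := by
    ext x
    change (f : G →ᵇ D) (x - -g - g) = (f : G →ᵇ D) x
    simp
  right_inv f := by
    ext x
    change (f : G →ᵇ D) (x - g - -g) = (f : G →ᵇ D) x
    simp
  map_mul' _ _ := rfl
  map_add' _ _ := rfl
  map_star' _ := rfl
  map_smul' _ _ := rfl

theorem translation_apply (g x : G) (f : inducedAlgebra α) :
    (translation α g f : G →ᵇ D) x = (f : G →ᵇ D) (x - g) := rfl

/-- The pointwise product `x ↦ k(x + H) f(x)` of `k ∈ C₀(G/H)` and `f` in the induced algebra. -/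
def mulC0Fun (k : C₀(G ⧸ H, ℂ)) (f : inducedAlgebra α) : inducedAlgebra α :=
  ⟨BoundedContinuousFunction.ofNormedAddCommGroup
      (fun x : G => k (x : G ⧸ H) • (f : G →ᵇ D) x)
      ((k.continuous.comp QuotientAddGroup.continuous_mk).smul (f : G →ᵇ D).continuous)
      (‖k‖ * ‖f‖) (fun x => by
        rw [norm_smul]
        exact mul_le_mul (k.toBCF.norm_coe_le_norm (x : G ⧸ H))
          ((f : G →ᵇ D).norm_coe_le_norm x) (norm_nonneg _) (norm_nonneg _)), by
    obtain ⟨f, hf⟩ := f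
    have hc : ∀ (x : G) (h : H), k ((x - h : G) : G ⧸ H) • f (x - h)
        = α h (k (x : G ⧸ H) • f x) := by
      intro x h
      have hx : ((x - h : G) : G ⧸ H) = (x : G ⧸ H) := by
        rw [QuotientAddGroup.mk_sub, (QuotientAddGroup.eq_zero_iff (h : G)).2 h.2, sub_zero]
      rw [hx, hf.1, map_smul]
    have hcont : Continuous fun x : G => k (x : G ⧸ H) • f x :=
      (k.continuous.comp QuotientAddGroup.continuous_mk).smul f.continuous
    refine ⟨hc, (exists_C0_iff α hcont hc).2 ?_⟩
    have h1 := ((exists_C0_iff α f.continuous hf.1).1 hf.2).const_mul ‖k‖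
    rw [mul_zero] at h1
    refine squeeze_zero (fun x => norm_nonneg _) (fun x => ?_) h1
    rw [norm_smul]
    exact mul_le_mul_of_nonneg_right (k.toBCF.norm_coe_le_norm (x : G ⧸ H)) (norm_nonneg _)⟩

theorem mulC0Fun_apply (k : C₀(G ⧸ H, ℂ)) (f : inducedAlgebra α) (x : G) :
    (mulC0Fun α k f : G →ᵇ D) x = k (x : G ⧸ H) • (f : G →ᵇ D) x := rfl

/-- Pointwise multiplication by `k ∈ C₀(G/H)` as a bounded operator on the induced algebra. -/
def mulC0CLM (k : C₀(G ⧸ H, ℂ)) : inducedAlgebra α →L[ℂ] inducedAlgebra α :=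
  LinearMap.mkContinuous
    { toFun := mulC0Fun α k
      map_add' := fun f g => by
        ext x; exact smul_add (k (x : G ⧸ H)) ((f : G →ᵇ D) x) ((g : G →ᵇ D) x)
      map_smul' := fun c f => by
        ext x; exact smul_comm (k (x : G ⧸ H)) c ((f : G →ᵇ D) x) }
    ‖k‖ (fun f => (BoundedContinuousFunction.norm_le (f := (mulC0Fun α k f : G →ᵇ D))
      (by positivity)).2 fun x => by
        rw [mulC0Fun_apply, norm_smul]
        exact mul_le_mul (k.toBCF.norm_coe_le_norm (x : G ⧸ H))
          ((f : G →ᵇ D).norm_coe_le_norm x) (norm_nonneg _) (norm_nonneg _))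

theorem mulC0CLM_apply (k : C₀(G ⧸ H, ℂ)) (f : inducedAlgebra α) (x : G) :
    (mulC0CLM α k f : G →ᵇ D) x = k (x : G ⧸ H) • (f : G →ᵇ D) x := rfl

/-- The homomorphism `j : C₀(G/H) → M(ind_H^G(D, α))` given by pointwise multiplication. -/
def mulC0 : C₀(G ⧸ H, ℂ) →⋆ₙₐ[ℂ] 𝓜(ℂ, inducedAlgebra α) where
  toFun k :=
    { fst := mulC0CLM α k
      snd := mulC0CLM α k
      central := fun f g => by
        ext x
        change (k (x : G ⧸ H) • (f : G →ᵇ D) x) * (g : G →ᵇ D) x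
          = (f : G →ᵇ D) x * (k (x : G ⧸ H) • (g : G →ᵇ D) x)
        rw [smul_mul_assoc, mul_smul_comm] }
  map_smul' c k := by
    apply DoubleCentralizer.ext
    refine Prod.ext ?_ ?_ <;>
    · ext f x
      exact smul_assoc c (k (x : G ⧸ H)) ((f : G →ᵇ D) x)
  map_zero' := by
    apply DoubleCentralizer.ext
    refine Prod.ext ?_ ?_ <;>
    · ext f x
      exact zero_smul ℂ ((f : G →ᵇ D) x)
  map_add' k l := by
    apply DoubleCentralizer.ext
    refine Prod.ext ?_ ?_ <;>
    · ext f x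
      exact add_smul (k (x : G ⧸ H)) (l (x : G ⧸ H)) ((f : G →ᵇ D) x)
  map_mul' k l := by
    apply DoubleCentralizer.ext
    refine Prod.ext ?_ ?_
    · ext f x
      exact mul_smul (k (x : G ⧸ H)) (l (x : G ⧸ H)) ((f : G →ᵇ D) x)
    · ext f x
      change (k (x : G ⧸ H) * l (x : G ⧸ H)) • (f : G →ᵇ D) x
        = l (x : G ⧸ H) • k (x : G ⧸ H) • (f : G →ᵇ D) x
      rw [mul_comm, mul_smul]
  map_star' k := by
    apply DoubleCentralizer.ext
    refine Prod.ext ?_ ?_ <;>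
    · ext f x
      change star (k (x : G ⧸ H)) • (f : G →ᵇ D) x
        = star (k (x : G ⧸ H) • star ((f : G →ᵇ D) x))
      rw [star_smul, star_star]

end

end

end InducedAlgebra

/-! Equivariance together with `π ∘ Ψ = ρ` forces `Ψ(e)(x) = ρ(γ_{-x}(e))`, which gives uniqueness
and dictates the definition of `Ψ`. Condition (ii) makes this function covariant, (iv) puts it into
the induced algebra, (iii) is injectivity, and (i) with the equivariance of `i` is compatibility
with `C₀(G/H)`.

For surjectivity, the range of the injective `*`-homomorphism `Ψ` is closed, so it suffices that it
is dense. It is a `C₀(G/H)`-submodule with `Ψ(γ_x(e))(x) = ρ(e)`, so any `f` can be matched at each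
point by an element `s` of the range. The continuous functions `x + H ↦ (ε - ‖s(x) - f(x)‖)⁺` on
`G/H` yield, after normalization, a partition of unity which patches finitely many of these elements
into an `ε`-approximation of `f`.
-/

namespace InducedAlgebra

section PartitionOfUnity

variable {X ι : Type*} [TopologicalSpace X]

theorem exists_finset_pos_le_sum {K : Set X} (hK : IsCompact K) {u : ι → C(X, ℝ)}
    (hu : ∀ i x, 0 ≤ u i x) (hpos : ∀ x ∈ K, ∃ i, 0 < u i x) :
    ∃ t : Finset ι, ∃ δ > 0, ∀ x ∈ K, δ ≤ ∑ i ∈ t, u i x := by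
  obtain ⟨t, ht⟩ := hK.elim_finite_subcover (fun i => {x | 0 < u i x})
    (fun i => isOpen_lt continuous_const (u i).continuous)
    fun x hx => Set.mem_iUnion.2 (hpos x hx)
  have hsum_pos : ∀ x ∈ K, 0 < ∑ i ∈ t, u i x := fun x hx =>
    let ⟨i, hi, hix⟩ := Set.mem_iUnion₂.1 (ht hx)
    Finset.sum_pos' (fun i _ => hu i x) ⟨i, hi, hix⟩
  have hcont : Continuous fun x => ∑ i ∈ t, u i x := by fun_prop
  exact ⟨t, hK.exists_forall_le' hcont.continuousOn hsum_pos⟩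

/-- A real `C₀` function regarded as a complex one; it turns the weights of a partition of unity
into elements acting on the induced algebra. -/
def ofRealC0 (k : C₀(X, ℝ)) : C₀(X, ℂ) where
  toFun x := (k x : ℂ)
  continuous_toFun := Complex.continuous_ofReal.comp k.continuous
  zero_at_infty' := (Complex.continuous_ofReal.tendsto' 0 0 Complex.ofReal_zero).comp
    k.zero_at_infty'

theorem ofRealC0_apply (k : C₀(X, ℝ)) (x : X) : ofRealC0 k x = (k x : ℂ) := rfl

theorem exists_C0_of_norm_le {f : X → ℝ} (hf : Continuous f) (κ : C₀(X, ℝ))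
    (h : ∀ x, ‖f x‖ ≤ ‖κ x‖) : ∃ k : C₀(X, ℝ), ∀ x, k x = f x :=
  ⟨⟨⟨f, hf⟩, squeeze_zero_norm h (tendsto_zero_iff_norm_tendsto_zero.1 κ.zero_at_infty')⟩,
    fun _ => rfl⟩

theorem exists_C0_cutoff (κ : C₀(X, ℝ)) {ε : ℝ} (hε : 0 < ε) :
    ∃ χ : C₀(X, ℝ), (∀ x, χ x ∈ Set.Icc 0 1) ∧ ∀ x, ε ≤ κ x → χ x = 1 := by
  obtain ⟨χ, hχ⟩ := exists_C0_of_norm_le (f := fun x => min 1 (|κ x| / ε)) (by fun_prop)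
    (ε⁻¹ • κ) fun x => by
      rw [Real.norm_of_nonneg (by positivity), ZeroAtInftyContinuousMap.smul_apply, norm_smul,
        norm_inv, Real.norm_of_nonneg hε.le, inv_mul_eq_div]
      exact min_le_right _ _
  refine ⟨χ, fun x => ?_, fun x hx => ?_⟩
  · rw [hχ]
    exact ⟨by positivity, min_le_left _ _⟩
  · rw [hχ, min_eq_left_iff, one_le_div hε]
    exact hx.trans (le_abs_self _)

theorem exists_C0_partition (κ : C₀(X, ℝ)) {ε : ℝ} (hε : 0 < ε) {u : ι → C(X, ℝ)}
    (hu : ∀ i x, 0 ≤ u i x) (hpos : ∀ x, ∃ i, 0 < u i x) :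
    ∃ (t : Finset ι) (p : t → C₀(X, ℝ)), (∀ i x, 0 ≤ p i x) ∧
      (∀ (i : t) x, u i x = 0 → p i x = 0) ∧ (∀ x, ∑ i, p i x ≤ 1) ∧
      ∀ x, ε ≤ κ x → ∑ i, p i x = 1 := by
  obtain ⟨K, hK, hκK⟩ := mem_cocompact.1 (κ.zero_at_infty'.eventually_lt_const hε)
  obtain ⟨t, δ, hδ, hδK⟩ := exists_finset_pos_le_sum hK hu fun x _ => hpos x
  obtain ⟨χ, hχ, hχ_one⟩ := exists_C0_cutoff κ hε
  let T : X → ℝ := fun x => ∑ i ∈ t, u i x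
  have hT : Continuous T := by fun_prop
  have hmax : ∀ x, 0 < max (T x) δ := fun x => lt_max_of_lt_right hδ
  have hle : ∀ (i : t) x, u i x / max (T x) δ ≤ 1 := fun i x =>
    (div_le_one (hmax x)).2 <|
      (Finset.single_le_sum (fun j _ => hu j x) i.2).trans (le_max_left _ _)
  have hex : ∀ i : t, ∃ p : C₀(X, ℝ), ∀ x, p x = u i x / max (T x) δ * χ x := fun i =>
    exists_C0_of_norm_le (.mul (.div (u i).continuous (hT.max continuous_const)
      fun x => (hmax x).ne') χ.continuous) χ fun x => by
        rw [norm_mul, Real.norm_of_nonneg (div_nonneg (hu i x) (hmax x).le)]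
        exact mul_le_of_le_one_left (norm_nonneg _) (hle i x)
  choose p hp using hex
  have hsum : ∀ x, ∑ i, p i x = T x / max (T x) δ * χ x := fun x => by
    simp only [hp, ← Finset.sum_mul, ← Finset.sum_div]
    rw [Finset.sum_coe_sort t fun i => u i x]
  refine ⟨t, p, fun i x => ?_, fun i x hux => ?_, fun x => ?_, fun x hx => ?_⟩
  · rw [hp]
    exact mul_nonneg (div_nonneg (hu i x) (hmax x).le) (hχ x).1
  · rw [hp, hux, zero_div, zero_mul]
  · rw [hsum]
    exact mul_le_one₀ ((div_le_one (hmax x)).2 (le_max_left _ _)) (hχ x).1 (hχ x).2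
  · have hxK : x ∈ K := by_contra fun hxK => (hκK hxK).not_ge hx
    rw [hsum, hχ_one x hx, mul_one, max_eq_left (hδK x hxK)]
    exact div_self (hδ.trans_le (hδK x hxK)).ne'

theorem norm_sum_smul_sub_le {V : Type*} [SeminormedAddCommGroup V] [NormedSpace ℝ V]
    {t : Finset ι} {w : ι → ℝ} {v : ι → V} {a : V} {δ : ℝ} (hw : ∀ i ∈ t, 0 ≤ w i)
    (hw_le : ∑ i ∈ t, w i ≤ 1) (hv : ∀ i ∈ t, w i ≠ 0 → ‖v i - a‖ ≤ δ)
    (ha : ∑ i ∈ t, w i ≠ 1 → ‖a‖ ≤ δ) : ‖∑ i ∈ t, w i • v i - a‖ ≤ δ := by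
  have hdecomp : ∑ i ∈ t, w i • v i - a =
      ∑ i ∈ t, w i • (v i - a) - (1 - ∑ i ∈ t, w i) • a := by
    simp only [smul_sub, Finset.sum_sub_distrib, ← Finset.sum_smul, sub_smul, one_smul]
    abel
  have hterm : ∀ i ∈ t, ‖w i • (v i - a)‖ ≤ w i * δ := fun i hi => by
    rw [norm_smul, Real.norm_of_nonneg (hw i hi)]
    rcases eq_or_ne (w i) 0 with h | h
    · simp only [h, zero_mul, le_refl]
    · exact mul_le_mul_of_nonneg_left (hv i hi h) (hw i hi)
  have hrest : ‖(1 - ∑ i ∈ t, w i) • a‖ ≤ (1 - ∑ i ∈ t, w i) * δ := by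
    rw [norm_smul, Real.norm_of_nonneg (sub_nonneg.2 hw_le)]
    rcases eq_or_ne (∑ i ∈ t, w i) 1 with h | h
    · simp only [h, sub_self, zero_mul, le_refl]
    · exact mul_le_mul_of_nonneg_left (ha h) (sub_nonneg.2 hw_le)
  calc ‖∑ i ∈ t, w i • v i - a‖
      ≤ ∑ i ∈ t, ‖w i • (v i - a)‖ + ‖(1 - ∑ i ∈ t, w i) • a‖ := by
        rw [hdecomp]
        exact (norm_sub_le _ _).trans (add_le_add_left (norm_sum_le _ _) _)
    _ ≤ ∑ i ∈ t, w i * δ + (1 - ∑ i ∈ t, w i) * δ :=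
        add_le_add (Finset.sum_le_sum hterm) hrest
    _ = δ := by rw [← Finset.sum_mul, ← add_mul, add_sub_cancel, one_mul]

end PartitionOfUnity

theorem CStarAction.add_apply {G A : Type*} [AddGroup G] [TopologicalSpace G]
    [NonUnitalCStarAlgebra A] (γ : CStarAction G A) (g h : G) (a : A) :
    γ (g + h) a = γ g (γ h a) := by
  rw [γ.map_add]
  rfl

theorem CStarAction.zero_apply {G A : Type*} [AddGroup G] [TopologicalSpace G]
    [NonUnitalCStarAlgebra A] (γ : CStarAction G A) (a : A) : γ 0 a = a := by
  rw [γ.map_zero]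
  rfl

theorem multiplierAut_fst_apply {A : Type*} [NonUnitalCStarAlgebra A] (φ : A ≃⋆ₐ[ℂ] A)
    (m : 𝓜(ℂ, A)) (a : A) : (multiplierAut φ m).fst (φ a) = φ (m.fst a) := by
  change φ (m.fst (φ.symm (φ a))) = φ (m.fst a)
  rw [StarAlgEquiv.symm_apply_apply]

theorem CStarAction.map_neg_sub {G D E : Type*} [AddCommGroup G] [TopologicalSpace G]
    {H : AddSubgroup G} [NonUnitalCStarAlgebra D] [NonUnitalCStarAlgebra E] {α : CStarAction H D}
    {γ : CStarAction G E} {ρ : E → D} (hρ : ∀ (h : H) (e : E), ρ (γ (h : G) e) = α h (ρ e))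
    (e : E) (x : G) (h : H) : ρ (γ (-(x - h)) e) = α h (ρ (γ (-x) e)) := by
  rw [neg_sub, sub_eq_add_neg, γ.add_apply, hρ]

open scoped CStarAlgebra in
theorem CStarAction.continuous_map_neg {G D E : Type*} [AddGroup G] [TopologicalSpace G]
    [ContinuousNeg G] [NonUnitalCStarAlgebra D] [NonUnitalCStarAlgebra E] (γ : CStarAction G E)
    (ρ : E →⋆ₙₐ[ℂ] D) (e : E) : Continuous fun x : G => ρ (γ (-x) e) :=
  (map_continuous ρ).comp ((γ.continuous_apply e).comp continuous_neg)

section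

variable {G : Type*} [AddCommGroup G] [TopologicalSpace G] [IsTopologicalAddGroup G]
  {H : AddSubgroup G} {D E : Type*} [NonUnitalCStarAlgebra D] [NonUnitalCStarAlgebra E]
  {α : CStarAction H D}

theorem mulC0_fst_apply (k : C₀(G ⧸ H, ℂ)) (f : inducedAlgebra α) (x : G) :
    ((mulC0 α k).fst f : G →ᵇ D) x = k (x : G ⧸ H) • (f : G →ᵇ D) x := rfl

theorem evalZero_translation_neg (x : G) (f : inducedAlgebra α) :
    evalZero α (translation α (-x) f) = (f : G →ᵇ D) x := by
  change (f : G →ᵇ D) (0 - -x) = (f : G →ᵇ D) x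
  rw [zero_sub, neg_neg]

theorem norm_sub_le_of_forall {f g : inducedAlgebra α} {ε : ℝ} (hε : 0 ≤ ε)
    (h : ∀ x, ‖(f : G →ᵇ D) x - (g : G →ᵇ D) x‖ ≤ ε) : ‖f - g‖ ≤ ε :=
  (BoundedContinuousFunction.norm_le (f := ((f - g : inducedAlgebra α) : G →ᵇ D)) hε).2 h

theorem mem_closure_of_forall_apply_mem_closure {S : AddSubmonoid (inducedAlgebra α)}
    (hmul : ∀ k : C₀(G ⧸ H, ℂ), ∀ s ∈ S, (mulC0 α k).fst s ∈ S) {f : inducedAlgebra α}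
    (hf : ∀ x, (f : G →ᵇ D) x ∈ closure ((fun s : inducedAlgebra α => (s : G →ᵇ D) x) '' S)) :
    f ∈ closure (S : Set (inducedAlgebra α)) := by
  refine Metric.mem_closure_iff.2 fun ε hε => ?_
  obtain ⟨κ, hκ⟩ := f.2.2
  choose k hk using fun s : S => ((s : inducedAlgebra α) - f).2.2
  have hpos : ∀ z, ∃ s, 0 < max (ε / 2 - k s z) 0 := fun z => by
    obtain ⟨x, rfl⟩ := QuotientAddGroup.mk_surjective z
    obtain ⟨_, ⟨s, hs, rfl⟩, hsx⟩ := Metric.mem_closure_iff.1 (hf x) (ε / 2) (half_pos hε)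
    refine ⟨⟨s, hs⟩, lt_max_of_lt_left (sub_pos.2 ?_)⟩
    rw [hk]
    exact (dist_eq_norm' _ _).symm.trans_lt hsx
  obtain ⟨t, p, hp_nonneg, hp_zero, hp_le, hp_one⟩ := exists_C0_partition κ (half_pos hε)
    (u := fun s => ⟨fun z => max (ε / 2 - k s z) 0, by fun_prop⟩) (fun _ _ => le_max_right _ _)
    hpos
  let g : inducedAlgebra α := ∑ s : t, (mulC0 α (ofRealC0 (p s))).fst (s : S)
  have hg : ∀ x, (g : G →ᵇ D) x = ∑ s : t, p s (x : G ⧸ H) • ((s : S) : G →ᵇ D) x := fun x => by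
    simp only [g, AddSubmonoidClass.coe_finsetSum, BoundedContinuousFunction.sum_apply,
      mulC0_fst_apply, ofRealC0_apply, Complex.coe_smul]
  have hgf : ‖g - f‖ ≤ ε / 2 := norm_sub_le_of_forall (half_pos hε).le fun x => by
    rw [hg]
    refine norm_sum_smul_sub_le (fun s _ => hp_nonneg s x) (hp_le x) (fun s _ hs => ?_) fun h => ?_
    · have hlt : 0 < ε / 2 - k s x := by
        contrapose! hs
        exact hp_zero s x (max_eq_right hs)
      exact (hk s x).symm.trans_le (sub_pos.1 hlt).le
    · rw [← hκ]
      exact (not_le.1 (mt (hp_one x) h)).le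
  refine ⟨g, S.sum_mem fun s _ => hmul _ _ (s : S).2, ?_⟩
  rw [dist_eq_norm']
  exact hgf.trans_lt (half_lt_self hε)

theorem surjective_of_mulC0_mem_range {Φ : E →⋆ₙₐ[ℂ] inducedAlgebra α}
    (hinj : Function.Injective Φ)
    (hmul : ∀ (k : C₀(G ⧸ H, ℂ)) (e : E), (mulC0 α k).fst (Φ e) ∈ Set.range Φ)
    (hdense : ∀ x, DenseRange fun e => (Φ e : G →ᵇ D) x) : Function.Surjective Φ := by
  intro f
  have hclosed : IsClosed (Set.range Φ) :=
    (NonUnitalStarAlgHom.isometry Φ hinj).isClosedEmbedding.isClosed_range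
  have hf : f ∈ closure (AddMonoidHom.mrange (Φ : E →+ inducedAlgebra α) : Set _) := by
    refine mem_closure_of_forall_apply_mem_closure ?_ fun x => ?_
    · rintro k _ ⟨e, rfl⟩
      exact hmul k e
    · rw [AddMonoidHom.coe_mrange, ← Set.range_comp]
      exact hdense x _
  rwa [AddMonoidHom.coe_mrange, AddMonoidHom.coe_coe, hclosed.closure_eq] at hf

theorem apply_eq_of_equivariant {A : Type*} {γ : G → A → A} {ρ : A → D} {Ψ : A → inducedAlgebra α}
    (hequiv : ∀ g a, Ψ (γ g a) = translation α g (Ψ a)) (heval : ∀ a, evalZero α (Ψ a) = ρ a)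
    (a : A) (x : G) : (Ψ a : G →ᵇ D) x = ρ (γ (-x) a) := by
  rw [← heval, hequiv, evalZero_translation_neg]

theorem tendsto_neg_comap_cocompact :
    Tendsto (fun x : G => -x) (comap (fun x : G => (x : G ⧸ H)) (cocompact (G ⧸ H)))
      (comap (fun x : G => (x : G ⧸ H)) (cocompact (G ⧸ H))) :=
  tendsto_comap_iff.2 <|
    (Homeomorph.neg (G ⧸ H)).isClosedEmbedding.tendsto_cocompact.comp tendsto_comap

section OrbitHom

variable {γ : CStarAction G E} {ρ : E →⋆ₙₐ[ℂ] D}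
  (hρ_equiv : ∀ (h : H) (e : E), ρ (γ (h : G) e) = α h (ρ e))
  (hρ_zero : ∀ e : E, Tendsto (fun x : G => ‖ρ (γ x e)‖)
    (comap (fun x : G => (x : G ⧸ H)) (cocompact (G ⧸ H))) (𝓝 0))

/-- The homomorphism of `E` into the induced algebra sending `e` to its orbit function
`x ↦ ρ(γ_{-x}(e))`; it is the isomorphism `Ψ` of the theorem. -/
noncomputable def orbitHom : E →⋆ₙₐ[ℂ] inducedAlgebra α where
  toFun e :=
    have hcont := γ.continuous_map_neg ρ e
    have hcov := CStarAction.map_neg_sub hρ_equiv e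
    ⟨.ofNormedAddCommGroup (fun x => ρ (γ (-x) e)) hcont ‖e‖
        fun x => (NonUnitalStarAlgHom.norm_apply_le ρ _).trans_eq (norm_aut _ e),
      hcov, (exists_C0_iff α hcont hcov).2 ((hρ_zero e).comp tendsto_neg_comap_cocompact)⟩
  map_smul' c e := by ext x; simp
  map_zero' := by ext x; simp
  map_add' e e' := by ext x; simp
  map_mul' e e' := by ext x; simp
  map_star' e := by ext x; simp [map_star]

theorem orbitHom_apply (e : E) (x : G) :
    (orbitHom hρ_equiv hρ_zero e : G →ᵇ D) x = ρ (γ (-x) e) := rfl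

theorem orbitHom_equivariant (g : G) (e : E) :
    orbitHom hρ_equiv hρ_zero (γ g e) = translation α g (orbitHom hρ_equiv hρ_zero e) := by
  ext x
  rw [translation_apply, orbitHom_apply, orbitHom_apply, ← γ.add_apply, neg_sub, neg_add_eq_sub]

theorem evalZero_orbitHom (e : E) : evalZero α (orbitHom hρ_equiv hρ_zero e) = ρ e := by
  change ρ (γ (-0) e) = ρ e
  rw [neg_zero, γ.zero_apply]

theorem mulC0_orbitHom {i : C₀(G ⧸ H, ℂ) → 𝓜(ℂ, E)}
    (hi_equiv : ∀ g k, i (translateC0 H g k) = multiplierAut (γ g) (i k))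
    (hi_fibre : ∀ k e, ρ ((i k).fst e) = k (0 : G ⧸ H) • ρ e) (k : C₀(G ⧸ H, ℂ)) (e : E) :
    (mulC0 α k).fst (orbitHom hρ_equiv hρ_zero e) = orbitHom hρ_equiv hρ_zero ((i k).fst e) := by
  ext x
  have hk : translateC0 H (-x) k ((0 : G) : G ⧸ H) = k (x : G ⧸ H) := by
    rw [translateC0_apply, zero_sub, neg_neg]
  rw [mulC0_fst_apply, orbitHom_apply, orbitHom_apply, ← multiplierAut_fst_apply, ← hi_equiv,
    hi_fibre, ← hk]
  rfl

theorem orbitHom_injective (h : ∀ e : E, (∀ g : G, ρ (γ g e) = 0) → e = 0) :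
    Function.Injective (orbitHom hρ_equiv hρ_zero) := by
  refine (injective_iff_map_eq_zero _).2 fun e he => h e fun g => ?_
  rw [← neg_neg g, ← orbitHom_apply hρ_equiv hρ_zero, he]
  rfl

theorem orbitHom_apply_surjective (hρ : Function.Surjective ρ) (x : G) :
    Function.Surjective fun e => (orbitHom hρ_equiv hρ_zero e : G →ᵇ D) x :=
  hρ.comp (γ (-x)).surjective

end OrbitHom

end

end InducedAlgebra

theorem theorem2p1_general {G D E : Type*}
    [AddCommGroup G] [TopologicalSpace G] [IsTopologicalAddGroup G] (H : AddSubgroup G)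
    [NonUnitalCStarAlgebra D] [NonUnitalCStarAlgebra E]
    (α : InducedAlgebra.CStarAction H D) (γ : InducedAlgebra.CStarAction G E)
    (ρ : E →⋆ₙₐ[ℂ] D) (hρ : Function.Surjective ρ)
    (i : C₀(G ⧸ H, ℂ) →⋆ₙₐ[ℂ] 𝓜(ℂ, E))
    (hi_equivariant : ∀ g k,
      i (InducedAlgebra.translateC0 H g k) = InducedAlgebra.multiplierAut (γ g) (i k))
    (h1 : ∀ (k : C₀(G ⧸ H, ℂ)) (e : E), ρ ((i k).fst e) = k (0 : G ⧸ H) • ρ e)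
    (h2 : ∀ (h : H) (e : E), ρ (γ (h : G) e) = α h (ρ e))
    (h3 : ∀ e : E, (∀ g : G, ρ (γ g e) = 0) → e = 0)
    (h4 : ∀ e : E, Tendsto (fun x : G => ‖ρ (γ x e)‖)
      (comap (fun x : G => (x : G ⧸ H)) (cocompact (G ⧸ H))) (𝓝 0)) :
    ∃ Ψ : E ≃⋆ₐ[ℂ] InducedAlgebra.inducedAlgebra α,
      (∀ (g : G) (e : E), Ψ (γ g e) = InducedAlgebra.translation α g (Ψ e)) ∧
      (∀ e : E, InducedAlgebra.evalZero α (Ψ e) = ρ e) ∧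
      (∀ (k : C₀(G ⧸ H, ℂ)) (e : E),
        (InducedAlgebra.mulC0 α k).fst (Ψ e) = Ψ ((i k).fst e)) ∧
      ∀ Ψ' : E ≃⋆ₐ[ℂ] InducedAlgebra.inducedAlgebra α,
        (∀ (g : G) (e : E), Ψ' (γ g e) = InducedAlgebra.translation α g (Ψ' e)) →
        (∀ e : E, InducedAlgebra.evalZero α (Ψ' e) = ρ e) →
        Ψ' = Ψ := by
  have hmul := InducedAlgebra.mulC0_orbitHom h2 h4 hi_equivariant h1
  have hinj := InducedAlgebra.orbitHom_injective h2 h4 h3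
  have hsurj := InducedAlgebra.surjective_of_mulC0_mem_range hinj
    (fun k e => ⟨_, (hmul k e).symm⟩)
    fun x => (InducedAlgebra.orbitHom_apply_surjective h2 h4 hρ x).denseRange
  refine ⟨StarAlgEquiv.ofBijective _ ⟨hinj, hsurj⟩, InducedAlgebra.orbitHom_equivariant h2 h4,
    InducedAlgebra.evalZero_orbitHom h2 h4, hmul, fun Ψ' hequiv heval => ?_⟩
  ext e x
  exact InducedAlgebra.apply_eq_of_equivariant (γ := fun g => γ g) hequiv heval e x

theorem theorem2p1 {G D E : Type*}
    [AddCommGroup G] [TopologicalSpace G] [IsTopologicalAddGroup G]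
    [LocallyCompactSpace G] [T2Space G]
    (H : AddSubgroup G) (hH : IsClosed (H : Set G))
    [NonUnitalCStarAlgebra D] [NonUnitalCStarAlgebra E]
    (α : InducedAlgebra.CStarAction H D) (γ : InducedAlgebra.CStarAction G E)
    (ρ : E →⋆ₙₐ[ℂ] D) (hρ : Function.Surjective ρ)
    (i : C₀(G ⧸ H, ℂ) →⋆ₙₐ[ℂ] 𝓜(ℂ, E))
    (hi_central : ∀ k, i k ∈ Set.center 𝓜(ℂ, E))
    (hi_equivariant : ∀ g k,
      i (InducedAlgebra.translateC0 H g k) = InducedAlgebra.multiplierAut (γ g) (i k))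
    (h1 : ∀ (k : C₀(G ⧸ H, ℂ)) (e : E), ρ ((i k).fst e) = k (0 : G ⧸ H) • ρ e)
    (h2 : ∀ (h : H) (e : E), ρ (γ (h : G) e) = α h (ρ e))
    (h3 : ∀ e : E, (∀ g : G, ρ (γ g e) = 0) → e = 0)
    (h4 : ∀ e : E, Tendsto (fun x : G => ‖ρ (γ x e)‖)
      (comap (fun x : G => (x : G ⧸ H)) (cocompact (G ⧸ H))) (𝓝 0)) :
    ∃ Ψ : E ≃⋆ₐ[ℂ] InducedAlgebra.inducedAlgebra α,
      (∀ (g : G) (e : E), Ψ (γ g e) = InducedAlgebra.translation α g (Ψ e)) ∧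
      (∀ e : E, InducedAlgebra.evalZero α (Ψ e) = ρ e) ∧
      (∀ (k : C₀(G ⧸ H, ℂ)) (e : E),
        (InducedAlgebra.mulC0 α k).fst (Ψ e) = Ψ ((i k).fst e)) ∧
      ∀ Ψ' : E ≃⋆ₐ[ℂ] InducedAlgebra.inducedAlgebra α,
        (∀ (g : G) (e : E), Ψ' (γ g e) = InducedAlgebra.translation α g (Ψ' e)) →
        (∀ e : E, InducedAlgebra.evalZero α (Ψ' e) = ρ e) →
        Ψ' = Ψ :=
  theorem2p1_general H α γ ρ hρ i hi_equivariant h1 h2 h3 h4
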